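/- Let $\mathcal X$ be a real Banach space and let $\mathcal A\subset\mathcal X\times\mathcal X$ be a (possibly multivalued) m-accretive operator with dense domain, i.e. $\|x-\hat x\|\le\|(x-\hat x)+\lambda(y-\hat y)\|$ for all $(x,y),(\hat x,\hat y)\in\mathcal A$ and $\lambda\ge 0$, $\operatorname{Rank}(I+\mathcal A)=\mathcal X$ (that is, the range of $I+\mathcal A$ is $\mathcal X$), and $\overline{D(\mathcal A)}=\mathcal X$. Let $S(t)x=\lim_{n\to\infty}\big(I+\tfrac tn\mathcal A\big)^{-n}x$ for $t>0$, $S(0)x=x$, be the contraction semigroup generated by $\mathcal A$. Let $0<T<\infty$, let $\phi:[0,T]\to[0,\infty)$ be integrable, and let $\vartheta:(0,\infty)\to(0,\infty)$ be continuous and nondecreasing with $\vartheta(0^+)=0$, extended by $\vartheta(0)=0$. Let $F:[0,T]\times\mathcal X\to\mathcal X$ satisfy $$\|F(t,v)-F(t,w)\|\le \phi(t)\,\vartheta(\|v-w\|)\qquad\text{for a.e. }t\in(0,T)\text{ and all }v,w\in\mathcal X .$$ A mild solution with initial datum $u_0\in\mathcal X$ is a function $u\in C([0,T];\mathcal X)$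 such that $F(\cdot,u(\cdot))\in L^1(0,T;\mathcal X)$ and $$u(t)=S(t)u_0+\int_0^tS(t-s)F(s,u(s))\,ds,\qquad 0\le t<T .$$ Let $u,\hat u$ be mild solutions with initial data $u_0,\hat u_0\in\mathcal X$, and write $\|u-\hat u\|_{\mathbb B_t}=\sup_{0\le s\le t}\|u(s)-\hat u(s)\|$. (i) If $\|u_0-\hat u_0\|>0$, then $$\int_{\|u_0-\hat u_0\|}^{\|u-\hat u\|_{\mathbb B_t}}\frac{ds}{\vartheta(s)}\le\int_0^t\phi(s)\,ds\qquad\text{for all }0\le t\le T .$$ (ii) If the Osgood condition $\int_{0^+}\frac{ds}{\vartheta(s)}=\infty$ holds (that is, $\int_0^\varepsilon\frac{ds}{\vartheta(s)}=\infty$ for every $\varepsilon>0$) and $u_0=\hat u_0$, then $\|u-\hat u\|_{\mathbb B_t}=0$ for all $0\le t\le T$, i.e. $u=\hat u$ on $[0,T]$. -/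

import Mathlib

open Set Filter Topology MeasureTheory

/-- A (possibly multivalued) operator on `X`, given by its graph `A ⊆ X × X`, is m-accretive:
it is accretive and the range of `I + A` is the whole space. -/
structure IsMAccretive {X : Type*} [NormedAddCommGroup X] [NormedSpace ℝ X]
    (A : Set (X × X)) : Prop where
  accretive : ∀ p ∈ A, ∀ q ∈ A, ∀ lam : ℝ, 0 ≤ lam →
    ‖p.1 - q.1‖ ≤ ‖(p.1 - q.1) + lam • (p.2 - q.2)‖
  range_id_add : ∀ x : X, ∃ p ∈ A, p.1 + p.2 = x

/-- The domain `D(A)` of a multivalued operator given by its graph. -/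
def opDomain {X : Type*} (A : Set (X × X)) : Set X := Prod.fst '' A

/-- The resolvent `J_lam = (I + lam A)⁻¹`: for `lam > 0` and `A` m-accretive, `resolventMap A lam x`
is the unique `y` with `x ∈ y + lam A y`. -/
noncomputable def resolventMap {X : Type*} [NormedAddCommGroup X] [NormedSpace ℝ X]
    (A : Set (X × X)) (lam : ℝ) (x : X) : X :=
  Classical.epsilon fun y : X => ∃ z : X, (y, z) ∈ A ∧ y + lam • z = x

open Classical in
/-- The nonlinear semigroup generated by `A`, through the exponential formula
`S(t) x = lim_{n → ∞} (I + (t / n) A)^{-n} x` for `t > 0`, and `S(0) x = x`. -/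
noncomputable def accretiveSemigroup {X : Type*} [NormedAddCommGroup X] [NormedSpace ℝ X]
    (A : Set (X × X)) (t : ℝ) (x : X) : X :=
  if t ≤ 0 then x
  else limUnder atTop fun n : ℕ => (resolventMap A (t / (n : ℝ)))^[n] x

/-- `u` is a mild solution on `[0, T]` of `u' + A u ∋ F(t, u)`, `u(0) = u₀`. -/
structure IsMildSolution {X : Type*} [NormedAddCommGroup X] [NormedSpace ℝ X]
    (A : Set (X × X)) (F : ℝ → X → X) (T : ℝ) (u₀ : X) (u : ℝ → X) : Prop where
  continuousOn : ContinuousOn u (Icc 0 T)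
  integrableOn : IntegrableOn (fun s => F s (u s)) (Ioo 0 T)
  eq_duhamel : ∀ t : ℝ, 0 ≤ t → t < T →
    u t = accretiveSemigroup A t u₀ + ∫ s in (0 : ℝ)..t, accretiveSemigroup A (t - s) (F s (u s))

/-- The norm `sup_{0 ≤ s ≤ t} ‖w(s)‖` of `C([0, t] : X)`, for `w` continuous on `[0, t]`. -/
noncomputable def supNormUpTo {X : Type*} [NormedAddCommGroup X] (t : ℝ) (w : ℝ → X) : ℝ :=
  sSup ((fun s => ‖w s‖) '' Icc 0 t)

/-- The Osgood condition `∫_{0⁺} ds / ϑ(s) = ∞`. -/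
def OsgoodCondition (ϑ : ℝ → ℝ) : Prop :=
  ∀ ε : ℝ, 0 < ε → ∫⁻ s in Ioc 0 ε, ENNReal.ofReal (1 / ϑ s) = ⊤

/-! Accretivity makes the resolvents nonexpansive, hence each `S(t)` as well. Subtracting the
Duhamel formulas, `g = ‖u - û‖` satisfies `g(t) ≤ a + ∫₀ᵗ φ ϑ(g)` with `a = ‖u₀ - û₀‖`
(`IsMildSolution.norm_sub_le`). The rest is scalar. Formally the right side `H` satisfies `H' ≤ φ
ϑ(H)`, so `∫ ds/ϑ` from `a` to `H(t)` is at most `∫₀ᵗ φ` (`bihari_majorant`); as `H` is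
nondecreasing, it also dominates the supremum of `g`. For equal data every `ε > 0` can serve as `a`,
and a value `g(t) = δ > 0` would bound `∫ ds/ϑ` over `[ε, δ]` uniformly in `ε`, against Osgood.
Since `S` is defined by a limit, its existence has to be proved: Kobayashi's estimate
(`norm_iterate_resolventMap_sub_iterate_le`) gives convergence and joint continuity of `S`, hence
integrability of the Duhamel integrands. -/

namespace IsMAccretive

/-! ### Range condition and resolvents -/

variable {X : Type*} [NormedAddCommGroup X] [NormedSpace ℝ X] {A : Set (X × X)}

/-- The range of `I + μ A` is the whole space as soon as that of `I + lam A` is and `lam < 2 μ`. -/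
theorem range_of_range [CompleteSpace X] (hA : IsMAccretive A) {lam μ : ℝ} (hlam : 0 < lam)
    (hμ : lam < 2 * μ) (h : ∀ x : X, ∃ y z : X, (y, z) ∈ A ∧ y + lam • z = x) (x : X) :
    ∃ y z : X, (y, z) ∈ A ∧ y + μ • z = x := by
  choose J Z hJA hJ using h
  have hμ0 : 0 < μ := by linarith
  have hJlip : ∀ a b, ‖J a - J b‖ ≤ ‖a - b‖ := fun a b => by
    have := hA.accretive _ (hJA a) _ (hJA b) lam hlam.le
    refine this.trans_eq ?_
    conv_rhs => rw [← hJ a, ← hJ b]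
    congr 1
    dsimp only
    module
  have hk : |1 - lam / μ| < 1 := by
    rw [abs_lt]
    constructor
    · have : lam / μ < 2 := by rwa [div_lt_iff₀ hμ0]
      linarith
    · have : 0 < lam / μ := by positivity
      linarith
  -- Solving `y + μ z = x` amounts to `y + lam z = (lam/μ) x + (1 - lam/μ) y`, a fixed point
  -- equation for `J`.
  have hc : ContractingWith ⟨|1 - lam / μ|, abs_nonneg _⟩
      (fun y => J ((lam / μ) • x + (1 - lam / μ) • y)) := by
    refine ⟨by exact_mod_cast hk, LipschitzWith.of_dist_le_mul fun a b => ?_⟩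
    rw [dist_eq_norm, dist_eq_norm]
    refine (hJlip _ _).trans_eq ?_
    rw [add_sub_add_left_eq_sub, ← smul_sub, norm_smul, Real.norm_eq_abs]
    rfl
  have : Nonempty X := ⟨0⟩
  have hfix := hc.fixedPoint_isFixedPt
  set y := ContractingWith.fixedPoint _ hc
  have hfix' : J ((lam / μ) • x + (1 - lam / μ) • y) = y := hfix
  have h1 := hJ ((lam / μ) • x + (1 - lam / μ) • y)
  have h2 := hJA ((lam / μ) • x + (1 - lam / μ) • y)
  rw [hfix'] at h1 h2
  refine ⟨y, _, h2, ?_⟩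
  set z := Z ((lam / μ) • x + (1 - lam / μ) • y)
  have h3 : lam • z = (lam / μ) • (x - y) := by
    rw [eq_sub_of_add_eq' h1]
    module
  have h4 : z = μ⁻¹ • (x - y) := by
    have := congrArg (fun w => lam⁻¹ • w) h3
    simp only [smul_smul] at this
    rw [inv_mul_cancel₀ hlam.ne', one_smul] at this
    rw [this]
    congr 1
    field_simp
  rw [h4, smul_smul, mul_inv_cancel₀ hμ0.ne']
  module

/-- An m-accretive operator satisfies the range condition for every positive parameter. -/
theorem range_id_add_smul [CompleteSpace X] (hA : IsMAccretive A) {lam : ℝ} (hlam : 0 < lam)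
    (x : X) : ∃ y z : X, (y, z) ∈ A ∧ y + lam • z = x := by
  -- Any ratio strictly between `1/2` and `1` would do in place of `2/3`: each step may almost halve
  -- the parameter.
  have key : ∀ n : ℕ, ∀ μ : ℝ, (2 / 3 : ℝ) ^ n ≤ μ →
      ∀ x : X, ∃ y z : X, (y, z) ∈ A ∧ y + μ • z = x := by
    intro n
    induction n with
    | zero =>
      intro μ hμ x
      refine hA.range_of_range one_pos (by norm_num at hμ; linarith) (fun x => ?_) x
      obtain ⟨p, hp, h⟩ := hA.range_id_add x
      exact ⟨p.1, p.2, hp, by rwa [one_smul]⟩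
    | succ n ih =>
      intro μ hμ x
      have : (0 : ℝ) < (2 / 3) ^ n := by positivity
      exact hA.range_of_range this (by rw [pow_succ] at hμ; linarith) (ih _ le_rfl) x
  obtain ⟨n, hn⟩ := exists_pow_lt_of_lt_one hlam (by norm_num : (2 / 3 : ℝ) < 1)
  exact key n lam hn.le x

variable [CompleteSpace X] (hA : IsMAccretive A)
include hA

theorem resolventMap_spec {lam : ℝ} (hlam : 0 < lam) (x : X) :
    ∃ z : X, (resolventMap A lam x, z) ∈ A ∧ resolventMap A lam x + lam • z = x :=
  Classical.epsilon_spec (hA.range_id_add_smul hlam x)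

theorem resolventMap_mem {lam : ℝ} (hlam : 0 < lam) (x : X) :
    (resolventMap A lam x, lam⁻¹ • (x - resolventMap A lam x)) ∈ A := by
  obtain ⟨z, hz, h⟩ := hA.resolventMap_spec hlam x
  convert hz
  rw [inv_smul_eq_iff₀ hlam.ne', sub_eq_iff_eq_add']
  exact h.symm

theorem norm_resolventMap_sub_le {lam : ℝ} (hlam : 0 < lam) (x y : X) :
    ‖resolventMap A lam x - resolventMap A lam y‖ ≤ ‖x - y‖ := by
  refine (hA.accretive _ (hA.resolventMap_mem hlam x) _ (hA.resolventMap_mem hlam y) lam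
    hlam.le).trans_eq ?_
  rw [← smul_sub, smul_inv_smul₀ hlam.ne']
  congr 1
  dsimp only
  abel

theorem norm_iterate_resolventMap_sub_le {lam : ℝ} (hlam : 0 < lam) (n : ℕ) (x y : X) :
    ‖(resolventMap A lam)^[n] x - (resolventMap A lam)^[n] y‖ ≤ ‖x - y‖ := by
  induction n with
  | zero => rfl
  | succ n ih =>
    simp only [Function.iterate_succ_apply']
    exact (hA.norm_resolventMap_sub_le hlam _ _).trans ih

theorem norm_resolventMap_sub_self_le {lam : ℝ} (hlam : 0 < lam) {x y : X} (hxy : (x, y) ∈ A) :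
    ‖resolventMap A lam x - x‖ ≤ lam * ‖y‖ := by
  refine (hA.accretive _ (hA.resolventMap_mem hlam x) _ hxy lam hlam.le).trans_eq ?_
  dsimp only
  rw [smul_sub lam, smul_inv_smul₀ hlam.ne', ← norm_neg]
  trans ‖lam • y‖
  · congr 1
    abel
  · rw [norm_smul, Real.norm_of_nonneg hlam.le]

theorem norm_iterate_resolventMap_sub_self_le {lam : ℝ} (hlam : 0 < lam) {x y : X}
    (hxy : (x, y) ∈ A) (n : ℕ) : ‖(resolventMap A lam)^[n] x - x‖ ≤ n * lam * ‖y‖ := by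
  induction n with
  | zero => simp
  | succ n ih =>
    have h1 := hA.norm_iterate_resolventMap_sub_le hlam n (resolventMap A lam x) x
    have h2 := hA.norm_resolventMap_sub_self_le hlam hxy
    rw [Function.iterate_succ_apply]
    have h3 := norm_sub_le_norm_sub_add_norm_sub ((resolventMap A lam)^[n] (resolventMap A lam x))
      ((resolventMap A lam)^[n] x) x
    push_cast
    linarith

/-! ### Crandall–Liggett estimate -/

/-- Kobayashi's recursive inequality for two resolvents of an m-accretive operator. -/
theorem norm_resolventMap_sub_resolventMap_le {lam μ : ℝ} (hlam : 0 < lam) (hμ : 0 < μ)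
    (p q : X) :
    (lam + μ) * ‖resolventMap A μ p - resolventMap A lam q‖ ≤
      lam * ‖p - resolventMap A lam q‖ + μ * ‖resolventMap A μ p - q‖ := by
  -- With this parameter the vector in the norm collapses to a convex combination of `p - Q` and `P
  -- - q`.
  have h := hA.accretive _ (hA.resolventMap_mem hμ p) _ (hA.resolventMap_mem hlam q)
    (lam * μ / (lam + μ)) (by positivity)
  dsimp only at h
  set P := resolventMap A μ p
  set Q := resolventMap A lam q
  have e : (P - Q) + (lam * μ / (lam + μ)) • (μ⁻¹ • (p - P) - lam⁻¹ • (q - Q))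
      = (lam + μ)⁻¹ • (lam • (p - Q) + μ • (P - q)) := by
    match_scalars <;> field_simp <;> ring
  rw [e, norm_smul, Real.norm_of_nonneg (by positivity), inv_mul_eq_div,
    le_div_iff₀ (by positivity), mul_comm] at h
  refine h.trans ((norm_add_le _ _).trans_eq ?_)
  rw [norm_smul, norm_smul, Real.norm_of_nonneg hlam.le, Real.norm_of_nonneg hμ.le]

/-- The Crandall–Liggett estimate in Kobayashi's form. -/
theorem norm_iterate_resolventMap_sub_iterate_le {lam μ : ℝ} (hlam : 0 < lam) (hμ : 0 < μ)
    {x y : X} (hxy : (x, y) ∈ A) (m n : ℕ) :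
    ‖(resolventMap A μ)^[m] x - (resolventMap A lam)^[n] x‖ ≤
      √((m * μ - n * lam) ^ 2 + m * μ * μ + n * lam * lam) * ‖y‖ := by
  induction m generalizing n with
  | zero =>
    rw [norm_sub_rev]
    refine (hA.norm_iterate_resolventMap_sub_self_le hlam hxy n).trans ?_
    refine mul_le_mul_of_nonneg_right (Real.le_sqrt_of_sq_le ?_) (norm_nonneg _)
    have : 0 ≤ n * lam * lam := by positivity
    push_cast
    nlinarith
  | succ m ihm =>
    induction n with
    | zero =>
      refine (hA.norm_iterate_resolventMap_sub_self_le hμ hxy (m + 1)).trans ?_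
      refine mul_le_mul_of_nonneg_right (Real.le_sqrt_of_sq_le ?_) (norm_nonneg _)
      have : 0 ≤ (m + 1 : ℕ) * μ * μ := by positivity
      push_cast at *
      nlinarith
    | succ n ihn =>
      have h := hA.norm_resolventMap_sub_resolventMap_le hlam hμ
        ((resolventMap A μ)^[m] x) ((resolventMap A lam)^[n] x)
      rw [← Function.iterate_succ_apply' (resolventMap A μ) m,
        ← Function.iterate_succ_apply' (resolventMap A lam) n] at h
      have h1 := ihm (n + 1)
      set a := ((m : ℝ) * μ - (n + 1 : ℕ) * lam) ^ 2 + m * μ * μ + (n + 1 : ℕ) * lam * lam with ha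
      set b := (((m + 1 : ℕ) : ℝ) * μ - n * lam) ^ 2 + (m + 1 : ℕ) * μ * μ + n * lam * lam with hb
      set c := (((m + 1 : ℕ) : ℝ) * μ - (n + 1 : ℕ) * lam) ^ 2 + (m + 1 : ℕ) * μ * μ +
        (n + 1 : ℕ) * lam * lam with hc
      have ha0 : 0 ≤ a := by positivity
      have hb0 : 0 ≤ b := by positivity
      have hc0 : 0 ≤ c := by positivity
      -- The radicand solves Kobayashi's recursion with equality; concavity of the square root turns
      -- this into the inequality `hs`.
      have habc : lam * a + μ * b = (lam + μ) * c := by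
        rw [ha, hb, hc]
        push_cast
        ring
      have hs : lam * √a + μ * √b ≤ (lam + μ) * √c := by
        refine abs_le_of_sq_le_sq' ?_ (by positivity) |>.2
        have e1 := Real.sq_sqrt ha0
        have e2 := Real.sq_sqrt hb0
        have e3 := Real.sq_sqrt hc0
        have : 0 ≤ lam * μ * (√a - √b) ^ 2 := by positivity
        calc (lam * √a + μ * √b) ^ 2
            ≤ (lam * √a + μ * √b) ^ 2 + lam * μ * (√a - √b) ^ 2 := by linarith
          _ = (lam + μ) * (lam * √a ^ 2 + μ * √b ^ 2) := by ring
          _ = ((lam + μ) * √c) ^ 2 := by rw [e1, e2, habc, mul_pow, e3]; ring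
      have hpos : 0 < lam + μ := by positivity
      refine le_of_mul_le_mul_left ?_ hpos
      have := mul_le_mul_of_nonneg_left h1 hlam.le
      have := mul_le_mul_of_nonneg_left ihn hμ.le
      have := mul_le_mul_of_nonneg_right hs (norm_nonneg y)
      linarith

theorem norm_iterate_div_sub_iterate_div_le {s t : ℝ} (hs : 0 < s) (ht : 0 < t) {x y : X}
    (hxy : (x, y) ∈ A) {m n : ℕ} (hm : 0 < m) (hn : 0 < n) :
    ‖(resolventMap A (s / m))^[m] x - (resolventMap A (t / n))^[n] x‖ ≤
      √((s - t) ^ 2 + s ^ 2 / m + t ^ 2 / n) * ‖y‖ := by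
  have hm' : (0 : ℝ) < m := by exact_mod_cast hm
  have hn' : (0 : ℝ) < n := by exact_mod_cast hn
  refine (hA.norm_iterate_resolventMap_sub_iterate_le (div_pos ht hn') (div_pos hs hm')
    hxy m n).trans_eq ?_
  congr 2
  field_simp

/-! ### The semigroup: existence and continuity -/

/-- The exponential formula converges on the closure of the domain. -/
theorem cauchySeq_iterate_resolventMap (hdom : Dense (opDomain A)) {t : ℝ} (ht : 0 < t) (x : X) :
    CauchySeq fun n : ℕ => (resolventMap A (t / n))^[n] x := by
  rw [Metric.cauchySeq_iff]
  intro ε hε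
  -- Two thirds of `ε` pay for replacing `x` by a point of the domain, one third for the estimate
  -- there.
  obtain ⟨_, hax, ⟨⟨a, b⟩, hab, rfl⟩⟩ := Metric.dense_iff.1 hdom x (ε / 3) (by positivity)
  dsimp only at hab hax
  rw [Metric.mem_ball, dist_eq_norm] at hax
  have hlim : Tendsto (fun N : ℕ => √(2 * t ^ 2 / N) * ‖b‖) atTop (𝓝 0) := by
    have := ((tendsto_const_div_atTop_nhds_zero_nat (2 * t ^ 2)).sqrt).mul_const ‖b‖
    simpa using this
  obtain ⟨N, hN, hN0⟩ := ((hlim.eventually (gt_mem_nhds (by positivity : 0 < ε / 3))).and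
    (eventually_gt_atTop 0)).exists
  refine ⟨N, fun m hm n hn => ?_⟩
  have hN' : (0 : ℝ) < N := by exact_mod_cast hN0
  have hm0 : 0 < m := hN0.trans_le hm
  have hn0 : 0 < n := hN0.trans_le hn
  have hm' : (N : ℝ) ≤ m := by exact_mod_cast hm
  have hn' : (N : ℝ) ≤ n := by exact_mod_cast hn
  have h1 := hA.norm_iterate_resolventMap_sub_le (div_pos ht (hN'.trans_le hm')) m x a
  have h2 := hA.norm_iterate_resolventMap_sub_le (div_pos ht (hN'.trans_le hn')) n a x
  have h3 := hA.norm_iterate_div_sub_iterate_div_le ht ht hab hm0 hn0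
  have h4 : √((t - t) ^ 2 + t ^ 2 / m + t ^ 2 / n) * ‖b‖ ≤ √(2 * t ^ 2 / N) * ‖b‖ := by
    refine mul_le_mul_of_nonneg_right (Real.sqrt_le_sqrt ?_) (norm_nonneg _)
    have e1 : t ^ 2 / m ≤ t ^ 2 / N := by gcongr
    have e2 : t ^ 2 / n ≤ t ^ 2 / N := by gcongr
    have e3 : 2 * t ^ 2 / N = t ^ 2 / N + t ^ 2 / N := by ring
    rw [e3, sub_self]
    linarith
  rw [norm_sub_rev] at hax
  rw [norm_sub_rev a x] at h2
  rw [dist_eq_norm]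
  have h5 := norm_sub_le_norm_sub_add_norm_sub ((resolventMap A (t / m))^[m] x)
    ((resolventMap A (t / m))^[m] a) ((resolventMap A (t / n))^[n] x)
  have h6 := norm_sub_le_norm_sub_add_norm_sub ((resolventMap A (t / m))^[m] a)
    ((resolventMap A (t / n))^[n] a) ((resolventMap A (t / n))^[n] x)
  linarith

theorem tendsto_accretiveSemigroup (hdom : Dense (opDomain A)) {t : ℝ} (ht : 0 < t) (x : X) :
    Tendsto (fun n : ℕ => (resolventMap A (t / n))^[n] x) atTop (𝓝 (accretiveSemigroup A t x)) := by
  rw [accretiveSemigroup, if_neg ht.not_ge]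
  exact (hA.cauchySeq_iterate_resolventMap hdom ht x).tendsto_limUnder

theorem norm_accretiveSemigroup_sub_le (hdom : Dense (opDomain A)) (t : ℝ) (x y : X) :
    ‖accretiveSemigroup A t x - accretiveSemigroup A t y‖ ≤ ‖x - y‖ := by
  rcases le_or_gt t 0 with ht | ht
  · simp [accretiveSemigroup, ht]
  · refine le_of_tendsto ((hA.tendsto_accretiveSemigroup hdom ht x).sub
      (hA.tendsto_accretiveSemigroup hdom ht y)).norm ?_
    filter_upwards [eventually_gt_atTop 0] with n hn
    exact hA.norm_iterate_resolventMap_sub_le (div_pos ht (by exact_mod_cast hn)) n x y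

theorem norm_accretiveSemigroup_sub_self_le (hdom : Dense (opDomain A)) {x y : X}
    (hxy : (x, y) ∈ A) {t : ℝ} (ht : 0 ≤ t) :
    ‖accretiveSemigroup A t x - x‖ ≤ t * ‖y‖ := by
  rcases ht.eq_or_lt with rfl | ht
  · simp [accretiveSemigroup]
  · refine le_of_tendsto ((hA.tendsto_accretiveSemigroup hdom ht x).sub_const x).norm ?_
    filter_upwards [eventually_gt_atTop 0] with n hn
    have hn' : (0 : ℝ) < n := by exact_mod_cast hn
    refine (hA.norm_iterate_resolventMap_sub_self_le (div_pos ht hn') hxy n).trans_eq ?_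
    field_simp

/-- As `n → ∞` only `(s - t)²` survives under the root. Negative times are harmless, `S` being the
identity there, so continuity holds on all of `ℝ × X`. -/
theorem norm_accretiveSemigroup_sub_accretiveSemigroup_le (hdom : Dense (opDomain A)) {x y : X}
    (hxy : (x, y) ∈ A) (s t : ℝ) :
    ‖accretiveSemigroup A s x - accretiveSemigroup A t x‖ ≤ |s - t| * ‖y‖ := by
  have hzero : ∀ r : ℝ, r ≤ 0 → accretiveSemigroup A r x = x := fun r hr => by
    simp [accretiveSemigroup, hr]
  rcases le_or_gt s 0 with hs | hs <;> rcases le_or_gt t 0 with ht | ht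
  · rw [hzero s hs, hzero t ht]
    simp only [sub_self, norm_zero]
    positivity
  · rw [hzero s hs, norm_sub_rev]
    refine (hA.norm_accretiveSemigroup_sub_self_le hdom hxy ht.le).trans ?_
    gcongr
    rw [abs_sub_comm]
    exact le_trans (by linarith) (le_abs_self _)
  · rw [hzero t ht]
    refine (hA.norm_accretiveSemigroup_sub_self_le hdom hxy hs.le).trans ?_
    gcongr
    exact le_trans (by linarith) (le_abs_self _)
  · have hlim : Tendsto (fun n : ℕ => √((s - t) ^ 2 + s ^ 2 / n + t ^ 2 / n) * ‖y‖) atTop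
        (𝓝 (|s - t| * ‖y‖)) := by
      have := (((tendsto_const_nhds (x := (s - t) ^ 2)).add
        (tendsto_const_div_atTop_nhds_zero_nat (s ^ 2))).add
        (tendsto_const_div_atTop_nhds_zero_nat (t ^ 2))).sqrt.mul_const ‖y‖
      simpa [Real.sqrt_sq_eq_abs] using this
    refine le_of_tendsto_of_tendsto ((hA.tendsto_accretiveSemigroup hdom hs x).sub
      (hA.tendsto_accretiveSemigroup hdom ht x)).norm hlim ?_
    filter_upwards [eventually_gt_atTop 0] with n hn
    exact hA.norm_iterate_div_sub_iterate_div_le hs ht hxy hn hn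

/-- The semigroup is jointly continuous in time and space. -/
theorem continuous_accretiveSemigroup (hdom : Dense (opDomain A)) :
    Continuous fun p : ℝ × X => accretiveSemigroup A p.1 p.2 := by
  refine continuous_prod_of_dense_continuous_lipschitzWith' _ 1 hdom (fun t => ?_) ?_
  · refine LipschitzWith.of_dist_le_mul fun x y => ?_
    rw [dist_eq_norm, dist_eq_norm, NNReal.coe_one, one_mul]
    exact hA.norm_accretiveSemigroup_sub_le hdom t x y
  · rintro _ ⟨⟨x, y⟩, hxy, rfl⟩
    refine (LipschitzWith.of_dist_le_mul (K := ‖y‖₊) fun s t => ?_).continuous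
    rw [dist_eq_norm, Real.dist_eq, mul_comm]
    exact hA.norm_accretiveSemigroup_sub_accretiveSemigroup_le hdom hxy s t

theorem intervalIntegrable_accretiveSemigroup_sub (hdom : Dense (opDomain A)) {t : ℝ}
    {f : ℝ → X} (hf : IntervalIntegrable f volume 0 t) :
    IntervalIntegrable (fun s => accretiveSemigroup A (t - s) (f s)) volume 0 t := by
  have hS := hA.continuous_accretiveSemigroup hdom
  -- `S(t) 0` need not vanish, so the dominating function includes its norm.
  have h0 : IntervalIntegrable (fun s => accretiveSemigroup A (t - s) 0) volume 0 t :=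
    (hS.comp (by fun_prop : Continuous fun s : ℝ => (t - s, (0 : X)))).intervalIntegrable _ _
  refine (hf.norm.add h0.norm).mono_fun ?_ (Eventually.of_forall fun s => ?_)
  · exact hS.comp_aestronglyMeasurable
      ((by fun_prop : Continuous fun s : ℝ => t - s).aestronglyMeasurable.prodMk
        (intervalIntegrable_iff.1 hf).aestronglyMeasurable)
  · have h1 := hA.norm_accretiveSemigroup_sub_le hdom (t - s) (f s) 0
    have h2 := norm_le_norm_sub_add (accretiveSemigroup A (t - s) (f s))
      (accretiveSemigroup A (t - s) 0)
    rw [sub_zero] at h1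
    exact le_trans (by dsimp only; linarith) (le_abs_self _)

end IsMAccretive

/-! ### Scalar inequalities of Bihari and Osgood -/

theorem integrableOn_mul_comp_of_monotoneOn {φ ϑ g : ℝ → ℝ} {T : ℝ}
    (hφ : IntegrableOn φ (Icc 0 T)) (hϑ : MonotoneOn ϑ (Ici 0)) (hϑ0 : ϑ 0 = 0)
    (hg : ContinuousOn g (Icc 0 T)) (hg0 : ∀ t, 0 ≤ g t) :
    IntegrableOn (fun s => φ s * ϑ (g s)) (Icc 0 T) := by
  obtain ⟨M, hM⟩ := isCompact_Icc.bddAbove_image hg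
  -- Truncation yields a function monotone on all of `ℝ`, hence Borel measurable.
  have hmono : Monotone fun x : ℝ => ϑ (max x 0) := fun x y hxy =>
    hϑ (mem_Ici.2 (le_max_right _ _)) (mem_Ici.2 (le_max_right _ _)) (max_le_max_right 0 hxy)
  have hmeas : AEStronglyMeasurable (fun s => ϑ (g s)) (volume.restrict (Icc 0 T)) := by
    have := hmono.measurable.comp_aemeasurable (hg.aemeasurable (μ := volume) measurableSet_Icc)
    refine this.aestronglyMeasurable.congr (Eventually.of_forall fun s => ?_)
    simp [hg0 s]
  refine (hφ.norm.mul_const (ϑ (max M 0))).mono' (hφ.aestronglyMeasurable.mul hmeas) ?_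
  refine (ae_restrict_iff' measurableSet_Icc).2 (Eventually.of_forall fun s hs => ?_)
  have h0 : 0 ≤ ϑ (g s) := hϑ0 ▸ hϑ self_mem_Ici (hg0 s) (hg0 s)
  rw [norm_mul, Real.norm_of_nonneg h0]
  refine mul_le_mul_of_nonneg_left (hϑ (hg0 s) (mem_Ici.2 (le_max_right _ _)) ?_) (norm_nonneg _)
  exact (hM (mem_image_of_mem g hs)).trans (le_max_left _ _)

theorem intervalIntegrable_one_div {ϑ : ℝ → ℝ} (hpos : ∀ x, 0 < x → 0 < ϑ x)
    (hcont : ContinuousOn ϑ (Ioi 0)) {a b : ℝ} (ha : 0 < a) (hb : 0 < b) :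
    IntervalIntegrable (fun s => 1 / ϑ s) volume a b := by
  have hsub : uIcc a b ⊆ Ioi 0 := fun x hx => (lt_min ha hb).trans_le hx.1
  exact (continuousOn_const.div (hcont.mono hsub)
    fun x hx => (hpos x (hsub hx)).ne').intervalIntegrable

/-- A function which is bounded by its own Bihari majorant satisfies Bihari's inequality. -/
theorem bihari_majorant {φ ϑ g : ℝ → ℝ} {T a : ℝ} (ha : 0 < a)
    (hφ : IntegrableOn φ (Icc 0 T)) (hφ0 : ∀ t ∈ Icc 0 T, 0 ≤ φ t)
    (hpos : ∀ x, 0 < x → 0 < ϑ x) (hcont : ContinuousOn ϑ (Ioi 0))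
    (hmono : MonotoneOn ϑ (Ici 0)) (hϑ0 : ϑ 0 = 0)
    (hg : ContinuousOn g (Icc 0 T)) (hg0 : ∀ t, 0 ≤ g t)
    (hbound : ∀ t ∈ Icc 0 T, g t ≤ a + ∫ s in (0 : ℝ)..t, φ s * ϑ (g s)) :
    ∀ t ∈ Icc 0 T, ∫ s in a..(a + ∫ s in (0 : ℝ)..t, φ s * ϑ (g s)), 1 / ϑ s ≤
      ∫ s in (0 : ℝ)..t, φ s := by
  rcases lt_or_ge T 0 with hT | hT
  · intro t ht
    exact absurd (ht.1.trans ht.2) hT.not_ge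
  have hprod := integrableOn_mul_comp_of_monotoneOn hφ hmono hϑ0 hg hg0
  have hϑg : ∀ s, 0 ≤ ϑ (g s) := fun s => hϑ0 ▸ hmono self_mem_Ici (hg0 s) (hg0 s)
  have hint : ∀ {f : ℝ → ℝ}, IntegrableOn f (Icc 0 T) → ∀ {x y : ℝ}, x ∈ Icc 0 T → y ∈ Icc 0 T →
      IntervalIntegrable f volume x y := fun {f} hf {x y} hx hy =>
    (hf.mono_set (uIcc_subset_Icc hx hy)).intervalIntegrable
  have h0T : (0 : ℝ) ∈ Icc 0 T := ⟨le_rfl, hT⟩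
  have hprim : ∀ {f : ℝ → ℝ}, IntegrableOn f (Icc 0 T) →
      ContinuousOn (fun t => ∫ s in (0 : ℝ)..t, f s) (Icc 0 T) := fun {f} hf => by
    rw [← uIcc_of_le hT] at hf ⊢
    exact intervalIntegral.continuousOn_primitive_interval hf
  set H : ℝ → ℝ := fun t => a + ∫ s in (0 : ℝ)..t, φ s * ϑ (g s) with hH
  set p : ℝ → ℝ := fun t => ∫ s in (0 : ℝ)..t, φ s with hp
  have hHcont : ContinuousOn H (Icc 0 T) := continuousOn_const.add (hprim hprod)
  have hHsub : ∀ {x y}, x ∈ Icc 0 T → y ∈ Icc 0 T → H y - H x = ∫ s in x..y, φ s * ϑ (g s) :=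
    fun {x y} hx hy => by
      simp only [hH]
      rw [add_sub_add_left_eq_sub, intervalIntegral.integral_interval_sub_left
        (hint hprod h0T hy) (hint hprod h0T hx)]
  have hHmono : MonotoneOn H (Icc 0 T) := fun x hx y hy hxy => by
    rw [← sub_nonneg, hHsub hx hy]
    exact intervalIntegral.integral_nonneg hxy fun s hs =>
      mul_nonneg (hφ0 s ⟨hx.1.trans hs.1, hs.2.trans hy.2⟩) (hϑg s)
  have hHa : ∀ t ∈ Icc 0 T, a ≤ H t := fun t ht => by
    have : H 0 ≤ H t := hHmono h0T ht ht.1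
    simpa [hH] using this
  have hH0 : ∀ t ∈ Icc 0 T, 0 < H t := fun t ht => ha.trans_le (hHa t ht)
  have hΦ : ContinuousOn (fun t => ∫ s in a..H t, 1 / ϑ s) (Icc 0 T) := by
    have h1 : ContinuousOn (fun x => ∫ s in a..x, 1 / ϑ s) (uIcc a (H T)) := by
      refine intervalIntegral.continuousOn_primitive_interval ?_
      exact (intervalIntegrable_iff' (by simp)).1
        (intervalIntegrable_one_div hpos hcont ha (hH0 T ⟨hT, le_rfl⟩))
    refine h1.comp hHcont fun t ht => ?_
    rw [uIcc_of_le (hHa T ⟨hT, le_rfl⟩)]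
    exact ⟨hHa t ht, hHmono ht ⟨hT, le_rfl⟩ ht.2⟩
  -- As `φ` is only integrable, `H` may fail to be differentiable at some points. The slack `η`
  -- allows a continuation argument instead: just to the right of `x`, `ϑ (H t) < (1 + η) * ϑ (H
  -- x)`, which compares the increments of both sides.
  have key : ∀ η : ℝ, 0 < η → ∀ t ∈ Icc 0 T, ∫ s in a..H t, 1 / ϑ s ≤ (1 + η) * p t := by
    intro η hη
    have hclosed : IsClosed ({t | ∫ s in a..H t, 1 / ϑ s ≤ (1 + η) * p t} ∩ Icc 0 T) := by
      have := isClosed_Icc.isClosed_le hΦ (continuousOn_const.mul (hprim hφ) :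
        ContinuousOn (fun t => (1 + η) * p t) (Icc 0 T))
      rwa [inter_comm]
    refine hclosed.Icc_subset_of_forall_exists_gt (by simp [hH, hp]) ?_
    rintro x ⟨hx, hx0, hxT⟩ y hy
    have hxI : x ∈ Icc 0 T := ⟨hx0, hxT.le⟩
    have hϑH : ContinuousOn (fun t => ϑ (H t)) (Icc 0 T) := hcont.comp hHcont hH0
    have hlt : ϑ (H x) < (1 + η) * ϑ (H x) := by nlinarith [hpos _ (hH0 x hxI)]
    have hev : ∀ᶠ t in 𝓝[Icc 0 T] x, ϑ (H t) < (1 + η) * ϑ (H x) :=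
      (hϑH x hxI).eventually (gt_mem_nhds hlt)
    have hle : 𝓝[Ioc x (min y T)] x ≤ 𝓝[Icc 0 T] x :=
      nhdsWithin_mono _ fun t ht => ⟨hx0.trans ht.1.le, ht.2.trans (min_le_right _ _)⟩
    have hne : (𝓝[Ioc x (min y T)] x).NeBot := by
      rw [nhdsWithin_Ioc_eq_nhdsGT (lt_min hy hxT)]
      infer_instance
    obtain ⟨t, ht, htI⟩ := ((hev.filter_mono hle).and self_mem_nhdsWithin).exists
    refine ⟨t, ?_, htI.1, htI.2.trans (min_le_left _ _)⟩
    have htI' : t ∈ Icc 0 T := ⟨hx0.trans htI.1.le, htI.2.trans (min_le_right _ _)⟩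
    have hxt : H x ≤ H t := hHmono hxI htI' htI.1.le
    have e1 : H t - H x ≤ ϑ (H t) * (p t - p x) := by
      rw [hHsub hxI htI', hp, intervalIntegral.integral_interval_sub_left
        (hint hφ h0T htI') (hint hφ h0T hxI), ← intervalIntegral.integral_const_mul]
      refine intervalIntegral.integral_mono_on htI.1.le (hint hprod hxI htI')
        ((hint hφ hxI htI').const_mul _) fun s hs => ?_
      have hsI : s ∈ Icc 0 T := ⟨hx0.trans hs.1, hs.2.trans htI'.2⟩
      rw [mul_comm]
      exact mul_le_mul_of_nonneg_right (hmono (hg0 s) (hH0 t htI').le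
        ((hbound s hsI).trans (hHmono hsI htI' hs.2))) (hφ0 s hsI)
    have e2 : ∫ s in H x..H t, 1 / ϑ s ≤ (H t - H x) * (1 / ϑ (H x)) := by
      rw [← smul_eq_mul, ← intervalIntegral.integral_const]
      refine intervalIntegral.integral_mono_on hxt
        (intervalIntegrable_one_div hpos hcont (hH0 x hxI) (hH0 t htI'))
        intervalIntegrable_const fun s hs => ?_
      exact one_div_le_one_div_of_le (hpos _ (hH0 x hxI))
        (hmono (hH0 x hxI).le ((hH0 x hxI).le.trans hs.1) hs.1)
    have hpx : 0 ≤ p t - p x := by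
      rw [hp, intervalIntegral.integral_interval_sub_left (hint hφ h0T htI') (hint hφ h0T hxI)]
      exact intervalIntegral.integral_nonneg htI.1.le fun s hs =>
        hφ0 s ⟨hx0.trans hs.1, hs.2.trans htI'.2⟩
    have e3 : (H t - H x) * (1 / ϑ (H x)) ≤ (1 + η) * (p t - p x) := by
      rw [mul_one_div, div_le_iff₀ (hpos _ (hH0 x hxI))]
      calc H t - H x ≤ ϑ (H t) * (p t - p x) := e1
        _ ≤ ((1 + η) * ϑ (H x)) * (p t - p x) := mul_le_mul_of_nonneg_right ht.le hpx
        _ = _ := by ring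
    have e4 := intervalIntegral.integral_add_adjacent_intervals
      (intervalIntegrable_one_div hpos hcont ha (hH0 x hxI))
      (intervalIntegrable_one_div hpos hcont (hH0 x hxI) (hH0 t htI'))
    have hx' : ∫ s in a..H x, 1 / ϑ s ≤ (1 + η) * p x := hx
    change ∫ s in a..H t, 1 / ϑ s ≤ (1 + η) * p t
    linarith
  intro t ht
  have hlim : Tendsto (fun η : ℝ => (1 + η) * p t) (𝓝[>] 0) (𝓝 (p t)) := by
    have : Continuous fun η : ℝ => (1 + η) * p t := by fun_prop
    have := (this.tendsto 0).mono_left (nhdsWithin_le_nhds (s := Ioi 0))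
    simpa using this
  refine ge_of_tendsto hlim ?_
  filter_upwards [self_mem_nhdsWithin] with η hη using key η hη t ht

/-- Bihari's inequality for values between the initial bound and the majorant. -/
theorem integral_one_div_le_of_le_majorant {φ ϑ g : ℝ → ℝ} {T a : ℝ} (ha : 0 < a)
    (hφ : IntegrableOn φ (Icc 0 T)) (hφ0 : ∀ t ∈ Icc 0 T, 0 ≤ φ t)
    (hpos : ∀ x, 0 < x → 0 < ϑ x) (hcont : ContinuousOn ϑ (Ioi 0))
    (hmono : MonotoneOn ϑ (Ici 0)) (hϑ0 : ϑ 0 = 0)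
    (hg : ContinuousOn g (Icc 0 T)) (hg0 : ∀ t, 0 ≤ g t)
    (hbound : ∀ t ∈ Icc 0 T, g t ≤ a + ∫ s in (0 : ℝ)..t, φ s * ϑ (g s))
    {t δ : ℝ} (ht : t ∈ Icc 0 T) (haδ : a ≤ δ)
    (hδ : δ ≤ a + ∫ s in (0 : ℝ)..t, φ s * ϑ (g s)) :
    ∫ s in a..δ, 1 / ϑ s ≤ ∫ s in (0 : ℝ)..t, φ s := by
  refine le_trans ?_ (bihari_majorant ha hφ hφ0 hpos hcont hmono hϑ0 hg hg0 hbound t ht)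
  have hδ0 := ha.trans_le haδ
  rw [← intervalIntegral.integral_add_adjacent_intervals
    (intervalIntegrable_one_div hpos hcont ha hδ0)
    (intervalIntegrable_one_div hpos hcont hδ0 (hδ0.trans_le hδ))]
  exact le_add_of_nonneg_right (intervalIntegral.integral_nonneg hδ fun s hs =>
    (one_div_pos.2 (hpos s (hδ0.trans_le hs.1))).le)

/-- Osgood's uniqueness criterion. -/
theorem eq_zero_of_osgoodCondition {φ ϑ g : ℝ → ℝ} {T : ℝ} (hO : OsgoodCondition ϑ)
    (hφ : IntegrableOn φ (Icc 0 T)) (hφ0 : ∀ t ∈ Icc 0 T, 0 ≤ φ t)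
    (hpos : ∀ x, 0 < x → 0 < ϑ x) (hcont : ContinuousOn ϑ (Ioi 0))
    (hmono : MonotoneOn ϑ (Ici 0)) (hϑ0 : ϑ 0 = 0)
    (hg : ContinuousOn g (Icc 0 T)) (hg0 : ∀ t, 0 ≤ g t)
    (hbound : ∀ t ∈ Icc 0 T, g t ≤ ∫ s in (0 : ℝ)..t, φ s * ϑ (g s)) :
    ∀ t ∈ Icc 0 T, g t = 0 := by
  intro t ht
  by_contra hne
  have hδ : 0 < g t := (hg0 t).lt_of_ne' hne
  set δ := g t with hδdef
  have hle : ∀ ε ∈ Ioc 0 δ, ∫ s in ε..δ, 1 / ϑ s ≤ ∫ s in (0 : ℝ)..t, φ s := fun ε hε =>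
    integral_one_div_le_of_le_majorant hε.1 hφ hφ0 hpos hcont hmono hϑ0 hg hg0
      (fun s hs => (hbound s hs).trans (le_add_of_nonneg_left hε.1.le)) ht hε.2
      ((hbound t ht).trans (le_add_of_nonneg_left hε.1.le))
  -- The bound `hle` is uniform in `ε`, so letting `ε = δ / (n + 1) → 0` makes `1 / ϑ` integrable up
  -- to `0`.
  have hint : IntegrableOn (fun s => 1 / ϑ s) (Ioc 0 δ) := by
    refine integrableOn_Ioc_of_intervalIntegral_norm_bounded_left (a := fun n : ℕ => δ / (n + 1))
      (l := atTop) (I := ∫ s in (0 : ℝ)..t, φ s) (fun n => ?_) ?_ (Eventually.of_forall fun n => ?_)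
    · have h1 : 0 < δ / (n + 1) := by positivity
      exact (intervalIntegrable_one_div hpos hcont h1 hδ).1
    · have := (tendsto_one_div_add_atTop_nhds_zero_nat (𝕜 := ℝ)).const_mul δ
      simpa [div_eq_mul_inv] using this
    · have h1 : 0 < δ / (n + 1) := by positivity
      have h2 : δ / (n + 1) ≤ δ := div_le_self hδ.le (by linarith [n.cast_nonneg (α := ℝ)])
      refine le_trans (le_of_eq ?_) (hle _ ⟨h1, h2⟩)
      rw [intervalIntegral.integral_of_le h2]
      refine setIntegral_congr_fun measurableSet_Ioc fun s hs => ?_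
      exact Real.norm_of_nonneg (one_div_pos.2 (hpos s (h1.trans hs.1))).le
  exact (hint.lintegral_lt_top).ne (hO δ hδ)

/-! ### Mild solutions and the main theorem -/

theorem IsMildSolution.apply_zero {X : Type*} [NormedAddCommGroup X] [NormedSpace ℝ X]
    {A : Set (X × X)} {F : ℝ → X → X} {T : ℝ} {u₀ : X} {u : ℝ → X} (hT : 0 < T)
    (hu : IsMildSolution A F T u₀ u) : u 0 = u₀ := by
  simpa [accretiveSemigroup] using hu.eq_duhamel 0 le_rfl hT

/-- The integral inequality satisfied by the distance of two mild solutions. -/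
theorem IsMildSolution.norm_sub_le {X : Type*} [NormedAddCommGroup X] [NormedSpace ℝ X]
    [CompleteSpace X] {A : Set (X × X)} (hA : IsMAccretive A) (hdom : Dense (opDomain A))
    {T : ℝ} (hT : 0 < T) {F : ℝ → X → X} {φ ϑ : ℝ → ℝ}
    (hφ : IntegrableOn φ (Icc 0 T)) (hmono : MonotoneOn ϑ (Ici 0)) (hϑ0 : ϑ 0 = 0)
    (hF : ∀ᵐ t ∂(volume.restrict (Ioo 0 T)), ∀ v w : X, ‖F t v - F t w‖ ≤ φ t * ϑ ‖v - w‖)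
    {u₀ û₀ : X} {u û : ℝ → X}
    (hu : IsMildSolution A F T u₀ u) (hû : IsMildSolution A F T û₀ û) :
    ∀ t ∈ Icc 0 T,
      ‖u t - û t‖ ≤ ‖u₀ - û₀‖ + ∫ s in (0 : ℝ)..t, φ s * ϑ ‖u s - û s‖ := by
  have hg : ContinuousOn (fun t => ‖u t - û t‖) (Icc 0 T) :=
    (hu.continuousOn.sub hû.continuousOn).norm
  have hprod := integrableOn_mul_comp_of_monotoneOn hφ hmono hϑ0 hg fun t => norm_nonneg _
  have hH : ContinuousOn (fun t => ‖u₀ - û₀‖ + ∫ s in (0 : ℝ)..t, φ s * ϑ ‖u s - û s‖)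
      (Icc 0 T) := by
    refine continuousOn_const.add ?_
    rw [← uIcc_of_le hT.le] at hprod ⊢
    exact intervalIntegral.continuousOn_primitive_interval hprod
  have hclosed := isClosed_Icc.isClosed_le hg hH
  -- Duhamel's formula is only available for `t < T`; the endpoint follows by continuity of both
  -- sides.
  have hIco : Ico 0 T ⊆ {t ∈ Icc 0 T |
      ‖u t - û t‖ ≤ ‖u₀ - û₀‖ + ∫ s in (0 : ℝ)..t, φ s * ϑ ‖u s - û s‖} := by
    rintro t ⟨ht0, htT⟩
    refine ⟨⟨ht0, htT.le⟩, ?_⟩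
    have hint : ∀ {v : ℝ → X}, IntegrableOn (fun s => F s (v s)) (Ioo 0 T) →
        IntervalIntegrable (fun s => accretiveSemigroup A (t - s) (F s (v s))) volume 0 t :=
      fun {v} hv => hA.intervalIntegrable_accretiveSemigroup_sub hdom <| by
        rw [intervalIntegrable_iff, uIoc_of_le ht0]
        exact hv.mono_set fun s hs => ⟨hs.1, hs.2.trans_lt htT⟩
    rw [hu.eq_duhamel t ht0 htT, hû.eq_duhamel t ht0 htT, add_sub_add_comm,
      ← intervalIntegral.integral_sub (hint hu.integrableOn) (hint hû.integrableOn)]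
    refine (norm_add_le _ _).trans (add_le_add (hA.norm_accretiveSemigroup_sub_le hdom _ _ _) ?_)
    have hF' : ∀ᵐ s ∂volume, s ∈ Ioc 0 t → ‖accretiveSemigroup A (t - s) (F s (u s)) -
        accretiveSemigroup A (t - s) (F s (û s))‖ ≤ φ s * ϑ ‖u s - û s‖ := by
      filter_upwards [(ae_restrict_iff' measurableSet_Ioo).1 hF] with s hs hst
      exact (hA.norm_accretiveSemigroup_sub_le hdom _ _ _).trans
        (hs ⟨hst.1, hst.2.trans_lt htT⟩ _ _)
    refine intervalIntegral.norm_integral_le_of_norm_le ht0 hF' ?_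
    refine (hprod.mono_set ?_).intervalIntegrable
    rw [uIcc_of_le ht0]
    exact Icc_subset_Icc_right htT.le
  have := closure_minimal hIco hclosed
  rw [closure_Ico hT.ne] at this
  exact fun t ht => (this ht).2

theorem corollary4p1 {X : Type*} [NormedAddCommGroup X] [NormedSpace ℝ X] [CompleteSpace X]
    (A : Set (X × X)) (hA : IsMAccretive A) (hdom : Dense (opDomain A))
    (T : ℝ) (hT : 0 < T) (F : ℝ → X → X) (φ ϑ : ℝ → ℝ)
    (hφ_int : IntegrableOn φ (Icc 0 T)) (hφ_nonneg : ∀ t ∈ Icc 0 T, 0 ≤ φ t)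
    (hϑ_pos : ∀ U : ℝ, 0 < U → 0 < ϑ U) (hϑ_cont : ContinuousOn ϑ (Ioi 0))
    (hϑ_mono : MonotoneOn ϑ (Ioi 0)) (hϑ_lim : Tendsto ϑ (𝓝[>] 0) (𝓝 0)) (hϑ_zero : ϑ 0 = 0)
    (hF : ∀ᵐ t ∂(volume.restrict (Ioo 0 T)), ∀ v w : X, ‖F t v - F t w‖ ≤ φ t * ϑ ‖v - w‖)
    (u₀ û₀ : X) (u û : ℝ → X)
    (hu : IsMildSolution A F T u₀ u) (hû : IsMildSolution A F T û₀ û) :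
    (0 < ‖u₀ - û₀‖ → ∀ t ∈ Icc 0 T,
      ∫ s in ‖u₀ - û₀‖..supNormUpTo t (fun r => u r - û r), 1 / ϑ s ≤ ∫ s in (0 : ℝ)..t, φ s) ∧
    (OsgoodCondition ϑ → ‖u₀ - û₀‖ = 0 →
      (∀ t ∈ Icc 0 T, supNormUpTo t (fun r => u r - û r) = 0) ∧ EqOn u û (Icc 0 T)) := by
  -- The distance of the solutions may vanish, so monotonicity is needed at `0` too.
  have hϑ_mono' : MonotoneOn ϑ (Ici 0) := by
    intro x hx y hy hxy
    rcases (mem_Ici.1 hx).eq_or_lt with rfl | hx'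
    · rw [hϑ_zero]
      rcases (mem_Ici.1 hy).eq_or_lt with rfl | hy'
      · exact hϑ_zero.ge
      · exact (hϑ_pos y hy').le
    · exact hϑ_mono hx' (hx'.trans_le hxy) hxy
  have hg : ContinuousOn (fun t => ‖u t - û t‖) (Icc 0 T) :=
    (hu.continuousOn.sub hû.continuousOn).norm
  have hg0 : ∀ t, 0 ≤ ‖u t - û t‖ := fun t => norm_nonneg _
  have hbound := hu.norm_sub_le hA hdom hT hφ_int hϑ_mono' hϑ_zero hF hû
  refine ⟨fun ha t ht => ?_, fun hO h0 => ?_⟩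
  · have hub : ∀ s ∈ Icc 0 t, ‖u s - û s‖ ≤
        ‖u₀ - û₀‖ + ∫ s in (0 : ℝ)..t, φ s * ϑ ‖u s - û s‖ := fun s hs => by
      refine (hbound s ⟨hs.1, hs.2.trans ht.2⟩).trans (add_le_add_right ?_ _)
      refine intervalIntegral.integral_mono_interval le_rfl hs.1 hs.2 ?_ ?_
      · refine (ae_restrict_iff' measurableSet_Ioc).2 (Eventually.of_forall fun r hr => ?_)
        exact mul_nonneg (hφ_nonneg r ⟨hr.1.le, hr.2.trans ht.2⟩)
          (hϑ_zero ▸ hϑ_mono' self_mem_Ici (hg0 r) (hg0 r))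
      · refine IntegrableOn.intervalIntegrable ((integrableOn_mul_comp_of_monotoneOn hφ_int
          hϑ_mono' hϑ_zero hg hg0).mono_set ?_)
        rw [uIcc_of_le ht.1]
        exact Icc_subset_Icc_right ht.2
    refine integral_one_div_le_of_le_majorant ha hφ_int hφ_nonneg hϑ_pos hϑ_cont hϑ_mono' hϑ_zero
      hg hg0 hbound ht ?_ ?_
    -- The initial distance is the value at `s = 0`, so the supremum lies between `a` and the
    -- majorant.
    · refine le_csSup ⟨_, forall_mem_image.2 hub⟩ ⟨0, ⟨le_rfl, ht.1⟩, ?_⟩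
      simp only [hu.apply_zero hT, hû.apply_zero hT]
    · exact csSup_le ((nonempty_Icc.2 ht.1).image _) (forall_mem_image.2 hub)
  · have hzero : ∀ t ∈ Icc 0 T, ‖u t - û t‖ = 0 :=
      eq_zero_of_osgoodCondition hO hφ_int hφ_nonneg hϑ_pos hϑ_cont hϑ_mono' hϑ_zero hg hg0
        (by simpa only [h0, zero_add] using hbound)
    refine ⟨fun t ht => ?_, fun t ht => sub_eq_zero.1 (norm_eq_zero.1 (hzero t ht))⟩
    have himg : (fun s => ‖u s - û s‖) '' Icc 0 t = {0} := by
      refine ((nonempty_Icc.2 ht.1).image _).subset_singleton_iff.1 ?_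
      rintro _ ⟨s, hs, rfl⟩
      exact hzero s ⟨hs.1, hs.2.trans ht.2⟩
    rw [supNormUpTo, himg, csSup_singleton]
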